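/- **Matrix completion, kernel regime.** Let $d, n \ge 1$, let $X^* \in \mathbb{R}^{d\times d}$ be a symmetric matrix, let $x_1,\dots,x_n \in [d]\times[d]$ be sampled positions (repetitions allowed), and let $\Omega=\{x_1,\dots,x_n\}$ be the set of observed entries. For $\theta=(U,V)$ with $U,V\in\mathbb{R}^{d\times d}$ put $W(\theta)=UU^\top-VV^\top$, and for $\lambda>0$ let $$\mathcal{L}_\lambda(\theta)=\frac1n\sum_{k=1}^n\bigl([W(\theta)]_{x_k}-X^*_{x_k}\bigr)^2+\frac{\lambda}{2}\bigl(\|U\|_F^2+\|V\|_F^2\bigr).$$ Let the weight decay $\lambda=\lambda(\alpha)>0$ be a function of $\alpha>0$ with $\lambda(\alpha)=\Theta(\alpha^{-p})$ as $\alpha\to+\infty$, for some constant $p>0$. For every $\alpha>0$, the gradient flow $\frac{\mathrm{d}\theta}{\mathrm{d}t}=-\nabla\mathcal{L}_{\lambda(\alpha)}(\theta)$ started from $\alpha\bar\theta_{\mathrm{init}}$, where $\bar\theta_{\mathrm{init}}=(I,I)$, exists for all $t\ge 0$; write $\theta(t;\alpha\bar\theta_{\mathrm{init}})$ for it. Then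 for every constant $c\in(0,1)$, with $T_c^-(\alpha)=\frac{1-c}{\lambda(\alpha)}\log\alpha$, it holds for all $(i,j)\in[d]\times[d]$ that $$\lim_{\alpha\to+\infty}\bigl[W(\theta(T_c^-(\alpha);\alpha\bar\theta_{\mathrm{init}}))\bigr]_{ij}=\begin{cases}X^*_{ij}&\text{if }(i,j)\in\Omega\text{ or }(j,i)\in\Omega,\\0&\text{otherwise.}\end{cases}$$ -/

import Mathlib

open Filter Topology Asymptotics

noncomputable section

namespace MatrixCompletion

/-- The parameter space `ℝ^{2d²}` of vectors `θ = (vec U, vec V)` with `U, V ∈ ℝ^{d×d}`, with the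
Euclidean norm, so that `‖θ‖² = ‖U‖_F² + ‖V‖_F²`. -/
abbrev Param (d : ℕ) : Type :=
  EuclideanSpace ℝ ((Fin d × Fin d) ⊕ (Fin d × Fin d))

/-- The vector `(vec U, vec V)`. -/
def pack {d : ℕ} (U V : Matrix (Fin d) (Fin d) ℝ) : Param d :=
  WithLp.toLp 2 (Sum.elim (fun q => U q.1 q.2) (fun q => V q.1 q.2))

/-- The block `U` of `θ = (vec U, vec V)`. -/
def matU {d : ℕ} (θ : Param d) : Matrix (Fin d) (Fin d) ℝ :=
  Matrix.of fun i j => θ (Sum.inl (i, j))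

/-- The block `V` of `θ = (vec U, vec V)`. -/
def matV {d : ℕ} (θ : Param d) : Matrix (Fin d) (Fin d) ℝ :=
  Matrix.of fun i j => θ (Sum.inr (i, j))

/-- The learned matrix `W(θ) = U Uᵀ - V Vᵀ`. -/
def matW {d : ℕ} (θ : Param d) : Matrix (Fin d) (Fin d) ℝ :=
  matU θ * (matU θ).transpose - matV θ * (matV θ).transpose

/-- The model output `f(θ; (i, j)) = ⟨e_i e_jᵀ, W(θ)⟩`, which is the `(i, j)` entry of `W(θ)`. -/
def modelOutput {d : ℕ} (θ : Param d) (q : Fin d × Fin d) : ℝ :=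
  matW θ q.1 q.2

/-- The training loss with weight decay `lam`: the mean over the samples of the squared error on
the sampled entries of `Xstar`, plus `(lam / 2) (‖U‖_F² + ‖V‖_F²)`. -/
def regLoss {d n : ℕ} (Xstar : Matrix (Fin d) (Fin d) ℝ) (x : Fin n → Fin d × Fin d) (lam : ℝ)
    (θ : Param d) : ℝ :=
  (1 / (n : ℝ)) * ∑ k, (modelOutput θ (x k) - Xstar (x k).1 (x k).2) ^ 2 + lam / 2 * ‖θ‖ ^ 2

/-- `θ : [0, ∞) → ℝ^{2d²}` is the trajectory of gradient flow on the regularized loss started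
from `θ₀`: `θ(0) = θ₀` and `dθ/dt = -∇L_lam(θ(t))` for all `t ≥ 0` (one-sided at `t = 0`). -/
def IsGradientFlow {d n : ℕ} (Xstar : Matrix (Fin d) (Fin d) ℝ) (x : Fin n → Fin d × Fin d)
    (lam : ℝ) (θ₀ : Param d) (θ : ℝ → Param d) : Prop :=
  θ 0 = θ₀ ∧
    ∀ t : ℝ, 0 ≤ t →
      HasDerivWithinAt θ (-gradient (regLoss Xstar x lam) (θ t)) (Set.Ici 0) t

/-- The initialization direction `(I, I)`. -/
def initDir (d : ℕ) : Param d := pack 1 1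

/-- The set `Ω` of observed entries. -/
def observed {d n : ℕ} (x : Fin n → Fin d × Fin d) : Finset (Fin d × Fin d) :=
  Finset.univ.image x

end MatrixCompletion

end

/-!
Dividing the flow by its scale `α e^{-λt}` removes the weight decay and leaves the linear system
`A' = -S A`, `B' = S B`, `A 0 = B 0 = 1`, where `S` is the symmetrized residual on the observed
entries. It preserves `Aᵀ B = 1`, so that `A Aᵀ + B Bᵀ = 2 + Γ` with `Γ = (A - B) (A - B)ᵀ`
positive semidefinite, and `D = A Aᵀ - B Bᵀ` satisfies `D' = -(4 S + S Γ + Γ S)`. Since `Γ` only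
helps the decay of the error, the observed error decays at a rate proportional to the squared
scale, which is at least `α^{2c}` up to the time `T_c⁻`, while the weight decay contributes a bias
of order `λ / α^{2c}`. Hence `∫ ‖S‖`, and with it `D`, is of order `log α / α^{2c}` at time `T_c⁻`.
An unobserved entry of `D` is driven by `Γ` alone; because `D² = 4 Γ + Γ²`, this is of second order
in `D`, so the entry is of order `(log α / α^{2c})³`, which vanishes even after multiplication by
the squared scale `α^{2c}`.
-/

noncomputable section

namespace MatrixCompletion

section GradientFlow

variable {E : Type*} [NormedAddCommGroup E]

open Manifold in
theorem exists_integralCurve_of_hasCompactSupport [NormedSpace ℝ E] [FiniteDimensional ℝ E]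
    {v : E → E} (hv : ContDiff ℝ 1 v) (hsupp : HasCompactSupport v) (x₀ : E) :
    ∃ γ : ℝ → E, γ 0 = x₀ ∧ ∀ t, HasDerivAt γ (v (γ t)) t := by
  obtain ⟨K, hK⟩ := hv.lipschitzWith_of_hasCompactSupport hsupp one_ne_zero
  obtain ⟨C, hC⟩ := hsupp.exists_bound_of_continuous hv.continuous
  have hlocal (a : ℝ) :
      ∃ γ, γ 0 = x₀ ∧ IsMIntegralCurveOn (I := 𝓘(ℝ, E)) γ v (Set.Ioo (-a) a) := by
    have hpl : IsPicardLindelof (fun _ : ℝ => v) (tmin := -|a|) (tmax := |a|)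
        ⟨0, by simp⟩ x₀ (C.toNNReal * ‖a‖₊) 0 C.toNNReal K :=
      .of_time_independent (fun x _ => (hC x).trans (Real.le_coe_toNNReal C))
        hK.lipschitzOnWith (by simp)
    obtain ⟨γ, hγ₀, hγ⟩ := hpl.exists_eq_forall_mem_Icc_hasDerivWithinAt₀
    have hsub : Set.Ioo (-a) a ⊆ Set.Icc (-|a|) |a| := fun t ht =>
      ⟨(neg_le_neg (le_abs_self a)).trans ht.1.le, ht.2.le.trans (le_abs_self a)⟩
    exact ⟨γ, hγ₀, fun t ht => ((hγ t (hsub ht)).mono hsub).hasFDerivWithinAt.hasMFDerivWithinAt⟩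
  obtain ⟨γ, hγ₀, hγ⟩ := (exists_isMIntegralCurve_iff_exists_isMIntegralCurveOn_Ioo
    (contMDiff_vectorSpace_iff_contDiff.2 hv) x₀).2 hlocal
  exact ⟨γ, hγ₀, fun t => (hγ t).hasFDerivAt⟩

variable [InnerProductSpace ℝ E]

theorem antitone_comp_of_hasDerivAt_neg_smul_gradient [CompleteSpace E] {f : E → ℝ}
    (hf : Differentiable ℝ f) {χ : E → ℝ} (hχ : ∀ x, 0 ≤ χ x) {γ : ℝ → E}
    (hγ : ∀ t, HasDerivAt γ (-(χ (γ t) • gradient f (γ t))) t) :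
    Antitone (f ∘ γ) := by
  have hderiv (t : ℝ) : HasDerivAt (f ∘ γ) (-(χ (γ t) * ‖gradient f (γ t)‖ ^ 2)) t := by
    refine ((hf (γ t)).hasGradientAt.hasFDerivAt.comp_hasDerivAt t (hγ t)).congr_deriv ?_
    rw [InnerProductSpace.toDual_apply_apply, inner_neg_right, inner_smul_right,
      real_inner_self_eq_norm_sq]
  exact antitone_of_hasDerivAt_nonpos hderiv fun t =>
    neg_nonpos.2 (mul_nonneg (hχ _) (sq_nonneg _))

theorem exists_gradientFlow_of_bounded_sublevel [FiniteDimensional ℝ E] {f : E → ℝ}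
    (hf : ContDiff ℝ 2 f) {x₀ : E} {R : ℝ} (hR : ∀ x, f x ≤ f x₀ → ‖x‖ ≤ R) :
    ∃ γ : ℝ → E, γ 0 = x₀ ∧
      ∀ t : ℝ, 0 ≤ t → HasDerivAt γ (-gradient f (γ t)) t := by
  have hR₀ : 0 ≤ R := (norm_nonneg x₀).trans (hR x₀ le_rfl)
  have hgrad : ContDiff ℝ 1 (gradient f) :=
    (InnerProductSpace.toDual ℝ E).symm.contDiff.comp (hf.fderiv_right one_add_one_eq_two.le)
  let χ : ContDiffBump (0 : E) := ⟨R + 1, R + 2, by linarith, by linarith⟩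
  obtain ⟨γ, hγ₀, hγ⟩ := exists_integralCurve_of_hasCompactSupport
    (χ.contDiff.smul hgrad).neg χ.hasCompactSupport.smul_right.neg x₀
  have hanti : Antitone (f ∘ γ) := antitone_comp_of_hasDerivAt_neg_smul_gradient
    (hf.differentiable two_ne_zero) (χ := χ) (fun _ => χ.nonneg) hγ
  refine ⟨γ, hγ₀, fun t ht => ?_⟩
  have hbound : ‖γ t‖ ≤ R := hR _ ((hanti ht).trans_eq (congrArg f hγ₀))
  have hχ : χ (γ t) = 1 := χ.one_of_mem_closedBall <| by
    simpa only [mem_closedBall_zero_iff] using hbound.trans (lt_add_one R).le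
  simpa only [Pi.neg_apply, Pi.smul_apply', hχ, one_smul] using hγ t

end GradientFlow

theorem le_exp_add_of_deriv_right_le {f f' : ℝ → ℝ} {k ε T : ℝ} (hk : 0 < k) (hε : 0 ≤ ε)
    (hf : ∀ t, 0 ≤ t → HasDerivWithinAt f (f' t) (Set.Ici 0) t)
    (hf' : ∀ t ∈ Set.Ico 0 T, f' t ≤ -k * f t + ε) {t : ℝ} (ht : t ∈ Set.Icc 0 T) :
    f t ≤ f 0 * Real.exp (-k * t) + ε / k := by
  have hcont : ContinuousOn f (Set.Icc 0 T) := fun s hs =>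
    (hf s hs.1).continuousWithinAt.mono Set.Icc_subset_Ici_self
  have hbound := le_gronwallBound_of_liminf_deriv_right_le hcont
    (fun s hs r hr => ((hf s hs.1).mono (Set.Ici_subset_Ici.2 hs.1)).liminf_right_slope_le hr)
    le_rfl hf' t ht
  rw [gronwallBound_of_K_ne_0 (neg_ne_zero.2 hk.ne'), sub_zero, div_neg] at hbound
  have hpos : 0 ≤ ε / k * Real.exp (-k * t) := by positivity
  linarith

theorem hasDerivWithinAt_linearMap_comp {E F : Type*} [NormedAddCommGroup E] [NormedSpace ℝ E]
    [FiniteDimensional ℝ E] [NormedAddCommGroup F] [NormedSpace ℝ F] (L : E →ₗ[ℝ] F)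
    {γ : ℝ → E} {γ' : E} {s : Set ℝ} {t : ℝ} (hγ : HasDerivWithinAt γ γ' s t) :
    HasDerivWithinAt (fun t => L (γ t)) (L γ') s t :=
  (LinearMap.toContinuousLinearMap L).hasFDerivAt.comp_hasDerivWithinAt t hγ

open Matrix

attribute [local instance] Matrix.frobeniusNormedAddCommGroup Matrix.frobeniusNormedSpace
  Matrix.frobeniusNormedRing Matrix.frobeniusNormedAlgebra

variable {ι κ : Type*} [Fintype ι] [Fintype κ]

section Frobenius

theorem frobenius_norm_sq (M : Matrix ι κ ℝ) : ‖M‖ ^ 2 = ∑ i, ∑ j, M i j ^ 2 := by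
  rw [frobenius_norm_def, ← Real.sqrt_eq_rpow, Real.sq_sqrt (by positivity)]
  simp only [Real.norm_eq_abs, Real.rpow_two, sq_abs]

theorem sum_sum_mul_eq_trace_transpose_mul (P Q : Matrix ι κ ℝ) :
    ∑ i, ∑ j, P i j * Q i j = trace (Pᵀ * Q) := by
  rw [Finset.sum_comm]
  simp only [trace, diag_apply, mul_apply, transpose_apply]

theorem frobenius_norm_sq_eq_trace (M : Matrix ι κ ℝ) : ‖M‖ ^ 2 = trace (Mᵀ * M) := by
  rw [frobenius_norm_sq, ← sum_sum_mul_eq_trace_transpose_mul]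
  simp only [pow_two]

theorem frobenius_norm_add_sq (P Q : Matrix ι κ ℝ) :
    ‖P + Q‖ ^ 2 = ‖P‖ ^ 2 + 2 * trace (Pᵀ * Q) + ‖Q‖ ^ 2 := by
  simp only [frobenius_norm_sq, ← sum_sum_mul_eq_trace_transpose_mul, Finset.mul_sum,
    ← Finset.sum_add_distrib, Matrix.add_apply]
  congr! 4
  ring

theorem neg_two_mul_trace_transpose_mul_le (P Q : Matrix ι κ ℝ) {ε : ℝ} (hε : 0 < ε) :
    -(2 * trace (Pᵀ * Q)) ≤ ε * ‖P‖ ^ 2 + ‖Q‖ ^ 2 / ε := by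
  have hsq := frobenius_norm_add_sq (ε • P) Q
  rw [norm_smul, Real.norm_of_nonneg hε.le, transpose_smul, smul_mul, trace_smul, smul_eq_mul]
    at hsq
  rw [← sub_nonneg]
  calc 0 ≤ ‖ε • P + Q‖ ^ 2 / ε := by positivity
    _ = _ := by rw [hsq]; field_simp; ring

theorem trace_transpose_mul_add_transpose {S : Matrix ι ι ℝ} (hS : S.IsSymm)
    (P Q : Matrix ι κ ℝ) :
    trace (Sᵀ * (Q * Pᵀ + P * Qᵀ)) = 2 * trace ((S * P)ᵀ * Q) := by
  have hQP : trace (S * (Q * Pᵀ)) = trace ((S * P)ᵀ * Q) := by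
    rw [transpose_mul, hS.eq, ← Matrix.mul_assoc, trace_mul_comm, Matrix.mul_assoc]
  have hPQ : trace (S * (P * Qᵀ)) = trace ((S * P)ᵀ * Q) := by
    rw [← Matrix.mul_assoc, trace_mul_comm, ← trace_transpose, transpose_mul, transpose_transpose]
  rw [hS.eq, Matrix.mul_add, trace_add, hQP, hPQ, two_mul]

theorem abs_apply_le_frobenius_norm (M : Matrix ι κ ℝ) (i : ι) (j : κ) : |M i j| ≤ ‖M‖ := by
  refine abs_le_of_sq_le_sq ?_ (norm_nonneg _)
  rw [frobenius_norm_sq, ← Fintype.sum_prod_type']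
  exact Finset.single_le_sum (f := fun q : ι × κ => M q.1 q.2 ^ 2) (fun _ _ => sq_nonneg _)
    (Finset.mem_univ (i, j))

theorem hasDerivWithinAt_transpose {m n : Type*} [Finite m] [Finite n] {M : ℝ → Matrix m n ℝ}
    {M' : Matrix m n ℝ} {s : Set ℝ} {t : ℝ} (hM : HasDerivWithinAt M M' s t) :
    HasDerivWithinAt (fun t => (M t)ᵀ) M'ᵀ s t := by
  have := Fintype.ofFinite m
  have := Fintype.ofFinite n
  exact hasDerivWithinAt_linearMap_comp (transposeLinearEquiv m n ℝ ℝ).toLinearMap hM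

theorem trace_transpose_mul_anticommutator_nonneg (S R : Matrix ι ι ℝ) :
    0 ≤ trace (Sᵀ * (S * (R * Rᵀ) + R * Rᵀ * S)) := by
  have hleft : trace (Sᵀ * (S * (R * Rᵀ))) = ‖S * R‖ ^ 2 := by
    rw [frobenius_norm_sq_eq_trace, transpose_mul, mul_assoc, trace_mul_comm Rᵀ]
    simp only [mul_assoc]
  have hright : trace (Sᵀ * (R * Rᵀ * S)) = ‖Rᵀ * S‖ ^ 2 := by
    rw [frobenius_norm_sq_eq_trace, transpose_mul, transpose_transpose]
    simp only [mul_assoc]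
  rw [mul_add, trace_add, hleft, hright]
  positivity

theorem norm_anticommutator_le (P Q : Matrix ι ι ℝ) :
    ‖P * Q + Q * P‖ ≤ 2 * (‖P‖ * ‖Q‖) := by
  linarith [norm_add_le (P * Q) (Q * P), frobenius_norm_mul P Q, frobenius_norm_mul Q P]

end Frobenius

section Gram

variable {R : Type*} [CommRing R] {m : Type*}

/-- The difference `P Pᵀ - Q Qᵀ` of the Gram matrices of `P` and `Q`; the learned matrix of
`θ = (U, V)` is `gramDiff U V`. -/
def gramDiff (P Q : Matrix m κ R) : Matrix m m R := P * Pᵀ - Q * Qᵀ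

/-- The Gram matrix of `P - Q`. When `Pᵀ Q = 1` it is the amount by which `P Pᵀ + Q Qᵀ` exceeds
its value `2` at `P = Q = 1`. -/
def gap (P Q : Matrix m κ R) : Matrix m m R := (P - Q) * (P - Q)ᵀ

theorem isSymm_gramDiff (P Q : Matrix m κ R) : (gramDiff P Q).IsSymm := by
  simp only [IsSymm, gramDiff, transpose_sub, transpose_mul, transpose_transpose]

theorem isSymm_gap (P Q : Matrix m κ R) : (gap P Q).IsSymm := by
  simp only [IsSymm, gap, transpose_mul, transpose_transpose]

variable [DecidableEq ι]

theorem mul_transpose_eq_one_of_transpose_mul_eq_one {P Q : Matrix ι ι R}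
    (h : Pᵀ * Q = 1) : P * Qᵀ = 1 := by
  rw [← transpose_transpose P, ← transpose_mul, mul_eq_one_comm.1 h, transpose_one]

theorem gram_add_gram {P Q : Matrix ι ι R} (h : Pᵀ * Q = 1) :
    P * Pᵀ + Q * Qᵀ = 2 + gap P Q := by
  have hPQ : P * Qᵀ = 1 := mul_transpose_eq_one_of_transpose_mul_eq_one h
  have hQP : Q * Pᵀ = 1 := mul_eq_one_comm.1 h
  rw [gap, transpose_sub, sub_mul, mul_sub, mul_sub, hPQ, hQP, ← one_add_one_eq_two]
  abel

theorem gramDiff_mul_self {P Q : Matrix ι ι R} (h : Pᵀ * Q = 1) :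
    gramDiff P Q * gramDiff P Q = 4 • gap P Q + gap P Q * gap P Q := by
  have hPQ : P * Pᵀ * (Q * Qᵀ) = 1 := by
    rw [mul_assoc, ← mul_assoc Pᵀ, h, one_mul, mul_transpose_eq_one_of_transpose_mul_eq_one h]
  have hQP : Q * Qᵀ * (P * Pᵀ) = 1 := mul_eq_one_comm.1 hPQ
  have hgap : gap P Q = P * Pᵀ + Q * Qᵀ - 2 := by rw [gram_add_gram h, add_sub_cancel_left]
  rw [hgap, gramDiff, ← one_add_one_eq_two]
  simp only [mul_sub, sub_mul, mul_add, add_mul, hPQ, hQP]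
  noncomm_ring

theorem norm_gap_le {P Q : Matrix ι ι ℝ} (h : Pᵀ * Q = 1) :
    ‖gap P Q‖ ≤ ‖gramDiff P Q‖ ^ 2 / 4 := by
  have htrace : ‖gap P Q‖ ≤ trace (gap P Q) := by
    calc ‖gap P Q‖ ≤ ‖P - Q‖ * ‖(P - Q)ᵀ‖ := frobenius_norm_mul _ _
      _ = trace (gap P Q) := by
        rw [frobenius_norm_transpose, ← pow_two, frobenius_norm_sq_eq_trace, trace_mul_comm, gap]
  have hsq : ‖gramDiff P Q‖ ^ 2 = 4 * trace (gap P Q) + ‖gap P Q‖ ^ 2 := by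
    rw [frobenius_norm_sq_eq_trace, (isSymm_gramDiff P Q).eq, gramDiff_mul_self h,
      frobenius_norm_sq_eq_trace, (isSymm_gap P Q).eq,
      trace_add, trace_smul, nsmul_eq_mul, Nat.cast_ofNat]
  linarith [sq_nonneg ‖gap P Q‖]

end Gram

section HyperbolicFlow

variable [DecidableEq ι]

/-- The pair `(A, B)` solves `A' = -S A`, `B' = S B` on `[0, ∞)` from `A 0 = B 0 = 1`, where `S`
is a curve of symmetric matrices. This is the form which gradient flow takes once the factor
`e^{-λt}` due to weight decay is divided out; for a constant `S` the solution is
`A t = e^{-tS}`, `B t = e^{tS}`, and `gramDiff (A t) (B t) = -2 sinh (2tS)`. -/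
structure IsHyperbolicFlow (S A B : ℝ → Matrix ι ι ℝ) : Prop where
  isSymm : ∀ t : ℝ, 0 ≤ t → (S t).IsSymm
  left_zero : A 0 = 1
  right_zero : B 0 = 1
  left_deriv : ∀ t : ℝ, 0 ≤ t → HasDerivWithinAt A (-(S t * A t)) (Set.Ici 0) t
  right_deriv : ∀ t : ℝ, 0 ≤ t → HasDerivWithinAt B (S t * B t) (Set.Ici 0) t

namespace IsHyperbolicFlow

variable {S A B : ℝ → Matrix ι ι ℝ}

theorem transpose_mul_eq_one (hf : IsHyperbolicFlow S A B) {t : ℝ} (ht : 0 ≤ t) :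
    (A t)ᵀ * B t = 1 := by
  have hderiv : ∀ s : ℝ, 0 ≤ s → HasDerivWithinAt (fun s => (A s)ᵀ * B s) 0 (Set.Ici 0) s := by
    intro s hs
    refine ((hasDerivWithinAt_transpose (hf.left_deriv s hs)).mul
      (hf.right_deriv s hs)).congr_deriv ?_
    rw [transpose_neg, transpose_mul, (hf.isSymm s hs).eq, neg_mul, mul_assoc]
    exact neg_add_cancel _
  have hconst := constant_of_has_deriv_right_zero (a := 0) (b := t)
    (fun s hs => (hderiv s hs.1).continuousWithinAt.mono Set.Icc_subset_Ici_self)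
    (fun s hs => (hderiv s hs.1).mono (Set.Ici_subset_Ici.2 hs.1)) t ⟨ht, le_rfl⟩
  rw [hconst, hf.left_zero, hf.right_zero, transpose_one, mul_one]

theorem gramDiff_zero (hf : IsHyperbolicFlow S A B) : gramDiff (A 0) (B 0) = 0 := by
  rw [gramDiff, hf.left_zero, hf.right_zero, sub_self]

theorem hasDerivWithinAt_gramDiff (hf : IsHyperbolicFlow S A B) {t : ℝ} (ht : 0 ≤ t) :
    HasDerivWithinAt (fun t => gramDiff (A t) (B t))
      (-(4 • S t + (S t * gap (A t) (B t) + gap (A t) (B t) * S t))) (Set.Ici 0) t := by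
  have hA := hf.left_deriv t ht
  have hB := hf.right_deriv t ht
  have hgap : gap (A t) (B t) = A t * (A t)ᵀ + B t * (B t)ᵀ - 2 :=
    eq_sub_of_add_eq' (gram_add_gram (hf.transpose_mul_eq_one ht)).symm
  refine ((hA.mul (hasDerivWithinAt_transpose hA)).sub
    (hB.mul (hasDerivWithinAt_transpose hB))).congr_deriv ?_
  rw [hgap, transpose_neg, transpose_mul, transpose_mul, (hf.isSymm t ht).eq,
    ← one_add_one_eq_two]
  noncomm_ring

theorem norm_gramDiff_le (hf : IsHyperbolicFlow S A B) {g G : ℝ → ℝ} {T : ℝ}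
    (hG : ∀ t, HasDerivAt G (g t) t) (hg : ∀ t, 0 < g t) (hG₀ : G 0 = 0)
    (hS : ∀ t ∈ Set.Icc 0 T, ‖S t‖ ≤ g t) (hT : 8 * G T ≤ 1) {t : ℝ} (ht : t ∈ Set.Icc 0 T) :
    ‖gramDiff (A t) (B t)‖ ≤ 8 * G t := by
  have hmono : Monotone G := (strictMono_of_hasDerivAt_pos hG hg).monotone
  refine image_norm_le_of_norm_deriv_right_lt_deriv_boundary (B := fun t => 8 * G t)
    (fun s hs => (hf.hasDerivWithinAt_gramDiff hs.1).continuousWithinAt.mono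
      Set.Icc_subset_Ici_self)
    (fun s hs => (hf.hasDerivWithinAt_gramDiff hs.1).mono (Set.Ici_subset_Ici.2 hs.1))
    (by simp only [hf.gramDiff_zero, norm_zero, hG₀, mul_zero, le_refl])
    (fun s => (hG s).const_mul 8) (fun s hs hboundary => ?_) ht
  have hgap : ‖gap (A s) (B s)‖ ≤ 1 / 4 := by
    have hdiff : ‖gramDiff (A s) (B s)‖ ≤ 1 := by linarith [hmono hs.2.le]
    nlinarith [norm_gap_le (hf.transpose_mul_eq_one hs.1), norm_nonneg (gramDiff (A s) (B s))]
  have hSs : ‖S s‖ ≤ g s := hS s ⟨hs.1, hs.2.le⟩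
  calc _ = ‖(4 : ℕ) • S s + (S s * gap (A s) (B s) + gap (A s) (B s) * S s)‖ := norm_neg _
    _ ≤ (4 : ℕ) * ‖S s‖ + 2 * (‖S s‖ * ‖gap (A s) (B s)‖) :=
      norm_add_le_of_le norm_nsmul_le (norm_anticommutator_le _ _)
    _ ≤ (4 : ℕ) * g s + 2 * (g s * (1 / 4)) := by gcongr; exact (hg s).le
    _ < 8 * g s := by linarith [hg s]

theorem abs_gramDiff_apply_le (hf : IsHyperbolicFlow S A B) {g G : ℝ → ℝ} {T : ℝ}
    (hG : ∀ t, HasDerivAt G (g t) t) (hg : ∀ t, 0 < g t) (hG₀ : G 0 = 0)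
    (hS : ∀ t ∈ Set.Icc 0 T, ‖S t‖ ≤ g t) (hT₀ : 0 ≤ T) (hT : 8 * G T ≤ 1) {i j : ι}
    (hij : ∀ t, S t i j = 0) : |gramDiff (A T) (B T) i j| ≤ 32 * G T ^ 3 := by
  have hmono : Monotone G := (strictMono_of_hasDerivAt_pos hG hg).monotone
  have hderiv (t : ℝ) (ht : 0 ≤ t) :=
    hasDerivWithinAt_linearMap_comp (entryLinearMap ℝ ℝ i j) (hf.hasDerivWithinAt_gramDiff ht)
  have hgap {t : ℝ} (ht : t ∈ Set.Icc 0 T) : ‖gap (A t) (B t)‖ ≤ 16 * G T ^ 2 := by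
    have hGt : 0 ≤ G t := hG₀.symm.trans_le (hmono ht.1)
    calc _ ≤ ‖gramDiff (A t) (B t)‖ ^ 2 / 4 := norm_gap_le (hf.transpose_mul_eq_one ht.1)
      _ ≤ (8 * G t) ^ 2 / 4 := by gcongr; exact hf.norm_gramDiff_le hG hg hG₀ hS hT ht
      _ ≤ (8 * G T) ^ 2 / 4 := by gcongr; exact hmono ht.2
      _ = 16 * G T ^ 2 := by ring
  have hbound := image_norm_le_of_norm_deriv_right_le_deriv_boundary (a := 0) (b := T)
    (B := fun t => 32 * G T ^ 2 * G t)
    (fun t ht => (hderiv t ht.1).continuousWithinAt.mono Set.Icc_subset_Ici_self)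
    (fun t ht => (hderiv t ht.1).mono (Set.Ici_subset_Ici.2 ht.1))
    (by simp only [hf.gramDiff_zero, map_zero, norm_zero, hG₀, mul_zero, le_refl])
    (fun t => (hG t).const_mul _) (fun t ht => ?_) ⟨hT₀, le_rfl⟩
  · calc |gramDiff (A T) (B T) i j| ≤ 32 * G T ^ 2 * G T := hbound
      _ = 32 * G T ^ 3 := by ring
  have htT : t ∈ Set.Icc 0 T := ⟨ht.1, ht.2.le⟩
  simp only [entryLinearMap_apply, Matrix.neg_apply, Matrix.add_apply, Matrix.smul_apply, hij t,
    smul_zero, zero_add, norm_neg]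
  calc _ ≤ ‖S t * gap (A t) (B t) + gap (A t) (B t) * S t‖ := abs_apply_le_frobenius_norm _ i j
    _ ≤ 2 * (‖S t‖ * ‖gap (A t) (B t)‖) := norm_anticommutator_le _ _
    _ ≤ 2 * (g t * (16 * G T ^ 2)) := by gcongr; exacts [(hg t).le, hS t htT, hgap htT]
    _ = 32 * G T ^ 2 * g t := by ring

end IsHyperbolicFlow

end HyperbolicFlow

section Residual

/-- The weighted squared error `∑ i j, a i j (W i j - X i j)²` of `W` against the target `X`. -/
def weightedError (a X W : Matrix ι κ ℝ) : ℝ := ∑ i, ∑ j, a i j * (W i j - X i j) ^ 2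

/-- The entrywise weighted residual `a ⊙ (W - X)`: half the gradient of `weightedError a X`
at `W`. -/
def residual (a X W : Matrix ι κ ℝ) : Matrix ι κ ℝ := a ⊙ (W - X)

theorem residual_apply {m n : Type*} (a X W : Matrix m n ℝ) (i : m) (j : n) :
    residual a X W i j = a i j * (W i j - X i j) := rfl

theorem isSymm_residual {m : Type*} {a X W : Matrix m m ℝ} (ha : a.IsSymm) (hX : X.IsSymm)
    (hW : W.IsSymm) : (residual a X W).IsSymm := by
  refine IsSymm.ext fun i j => ?_
  rw [residual_apply, residual_apply, ha.apply, hX.apply, hW.apply]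

theorem weightedError_eq_trace (a X W : Matrix ι κ ℝ) :
    weightedError a X W = trace ((residual a X W)ᵀ * (W - X)) := by
  simp only [weightedError, ← sum_sum_mul_eq_trace_transpose_mul, residual_apply,
    Matrix.sub_apply, mul_assoc, pow_two]

theorem hasDerivWithinAt_weightedError (a X : Matrix ι κ ℝ) {W : ℝ → Matrix ι κ ℝ}
    {W' : Matrix ι κ ℝ} {s : Set ℝ} {t : ℝ} (hW : HasDerivWithinAt W W' s t) :
    HasDerivWithinAt (fun t => weightedError a X (W t))
      (2 * trace ((residual a X (W t))ᵀ * W')) s t := by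
  have hentry (i : ι) (j : κ) := ((((hasDerivWithinAt_linearMap_comp (entryLinearMap ℝ ℝ i j)
    hW).sub_const (X i j)).pow 2).const_mul (a i j))
  refine (HasDerivWithinAt.fun_sum fun i _ =>
    HasDerivWithinAt.fun_sum fun j _ => hentry i j).congr_deriv ?_
  simp only [← sum_sum_mul_eq_trace_transpose_mul, Finset.mul_sum, residual_apply,
    entryLinearMap_apply]
  congr! 2
  ring

variable {a : Matrix ι κ ℝ}

theorem weightedError_nonneg (ha : ∀ i j, 0 ≤ a i j) (X W : Matrix ι κ ℝ) :
    0 ≤ weightedError a X W :=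
  Finset.sum_nonneg fun i _ => Finset.sum_nonneg fun j _ => mul_nonneg (ha i j) (sq_nonneg _)

theorem mul_sub_sq_le_weightedError (ha : ∀ i j, 0 ≤ a i j) (X W : Matrix ι κ ℝ) (i : ι) (j : κ) :
    a i j * (W i j - X i j) ^ 2 ≤ weightedError a X W := by
  rw [weightedError, ← Fintype.sum_prod_type']
  exact Finset.single_le_sum (f := fun q : ι × κ => a q.1 q.2 * (W q.1 q.2 - X q.1 q.2) ^ 2)
    (fun q _ => mul_nonneg (ha q.1 q.2) (sq_nonneg _)) (Finset.mem_univ (i, j))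

theorem tendsto_apply_of_tendsto_weightedError {τ : Type*} {l : Filter τ} {X : Matrix ι κ ℝ}
    {W : τ → Matrix ι κ ℝ} (ha : ∀ i j, 0 ≤ a i j)
    (hW : Tendsto (fun u => weightedError a X (W u)) l (𝓝 0)) {i : ι} {j : κ} (hij : 0 < a i j) :
    Tendsto (fun u => W u i j) l (𝓝 (X i j)) := by
  have hsq : Tendsto (fun u => (W u i j - X i j) ^ 2) l (𝓝 0) := by
    refine squeeze_zero (fun _ => sq_nonneg _) (fun u => ?_)
      (by simpa only [zero_div] using hW.div_const (a i j))
    rw [le_div_iff₀' hij]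
    exact mul_sub_sq_le_weightedError ha X (W u) i j
  refine tendsto_iff_norm_sub_tendsto_zero.2 ?_
  simpa only [Real.norm_eq_abs, Real.sqrt_sq_eq_abs, Real.sqrt_zero] using hsq.sqrt

theorem norm_residual_sq_le {K : ℝ} (ha : ∀ i j, a i j ^ 2 ≤ K * a i j) (X W : Matrix ι κ ℝ) :
    ‖residual a X W‖ ^ 2 ≤ K * weightedError a X W := by
  simp only [frobenius_norm_sq, weightedError, Finset.mul_sum, residual_apply, mul_pow,
    ← mul_assoc]
  gcongr with i _ j _
  exact ha i j

theorem mul_weightedError_le_norm_residual_sq {k : ℝ} (ha : ∀ i j, k * a i j ≤ a i j ^ 2)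
    (X W : Matrix ι κ ℝ) : k * weightedError a X W ≤ ‖residual a X W‖ ^ 2 := by
  simp only [frobenius_norm_sq, weightedError, Finset.mul_sum, residual_apply, mul_pow,
    ← mul_assoc]
  gcongr with i _ j _
  exact ha i j

theorem neg_four_mul_trace_residual_mul_le (ha : ∀ i j, 0 ≤ a i j) (X W : Matrix ι κ ℝ)
    {lam m : ℝ} (hlam : 0 ≤ lam) (hm : 0 < m) :
    -(4 * lam * trace ((residual a X W)ᵀ * W)) ≤
      4 * m * ‖residual a X W‖ ^ 2 + lam ^ 2 * ‖X‖ ^ 2 / m := by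
  set S := residual a X W
  have hsplit : trace (Sᵀ * W) = weightedError a X W + trace (Sᵀ * X) := by
    rw [weightedError_eq_trace, Matrix.mul_sub, trace_sub, sub_add_cancel]
  have hcross : -(4 * lam * trace (Sᵀ * X)) ≤ 4 * m * ‖S‖ ^ 2 + lam ^ 2 * ‖X‖ ^ 2 / m := by
    have hyoung := neg_two_mul_trace_transpose_mul_le S ((2 * lam) • X) (ε := 4 * m)
      (by positivity)
    rw [Matrix.mul_smul, trace_smul, norm_smul, smul_eq_mul, mul_pow, Real.norm_eq_abs,
      sq_abs] at hyoung
    convert hyoung using 2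
    · ring
    · field_simp
      ring
  rw [hsplit]
  linarith [mul_nonneg hlam (weightedError_nonneg ha X W)]

end Residual

section ErrorDecay

variable [DecidableEq ι] {a X : Matrix ι ι ℝ} {S A B : ℝ → Matrix ι ι ℝ} {μ : ℝ → ℝ}
  {k lam m : ℝ}

namespace IsHyperbolicFlow

theorem hasDerivWithinAt_smul_gramDiff (hf : IsHyperbolicFlow S A B) {t : ℝ} (ht : 0 ≤ t)
    (hμ : HasDerivAt μ (-(2 * lam * μ t)) t) :
    HasDerivWithinAt (fun t => μ t • gramDiff (A t) (B t))
      (-((2 * lam) • μ t • gramDiff (A t) (B t) +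
        μ t • (4 • S t + (S t * gap (A t) (B t) + gap (A t) (B t) * S t)))) (Set.Ici 0) t := by
  refine (hμ.hasDerivWithinAt.smul (hf.hasDerivWithinAt_gramDiff ht)).congr_deriv ?_
  rw [smul_neg, neg_smul, ← smul_smul]
  abel

/-- Young's inequality spends half of the decay rate `8 m k` of the error on the bias due to the
weight decay. -/
theorem weightedError_le
    (hf : IsHyperbolicFlow (fun t => residual a X (μ t • gramDiff (A t) (B t))) A B)
    (ha : ∀ i j, 0 ≤ a i j) (hk : 0 < k) (hak : ∀ i j, k * a i j ≤ a i j ^ 2)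
    (hlam : 0 ≤ lam) (hμ : ∀ t, HasDerivAt μ (-(2 * lam * μ t)) t)
    (hm : 0 < m) {T : ℝ} (hμm : ∀ t ∈ Set.Icc 0 T, m ≤ μ t) {t : ℝ} (ht : t ∈ Set.Icc 0 T) :
    weightedError a X (μ t • gramDiff (A t) (B t)) ≤
      weightedError a X 0 * Real.exp (-(4 * m * k) * t) +
        lam ^ 2 * ‖X‖ ^ 2 / m / (4 * m * k) := by
  have hderiv (s : ℝ) (hs : 0 ≤ s) := hasDerivWithinAt_weightedError a X
    (hf.hasDerivWithinAt_smul_gramDiff hs (hμ s))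
  have hdecay := le_exp_add_of_deriv_right_le (k := 4 * m * k) (ε := lam ^ 2 * ‖X‖ ^ 2 / m)
    (by positivity) (by positivity) hderiv (fun s hs => ?_) ht
  · simpa only [hf.gramDiff_zero, smul_zero] using hdecay
  set W := μ s • gramDiff (A s) (B s)
  set S := residual a X W
  set Γ := gap (A s) (B s)
  have hexpand : 2 * trace (Sᵀ * -((2 * lam) • W + μ s • (4 • S + (S * Γ + Γ * S)))) =
      -(4 * lam * trace (Sᵀ * W)) - 8 * (μ s * ‖S‖ ^ 2) -
        2 * (μ s * trace (Sᵀ * (S * Γ + Γ * S))) := by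
    simp only [frobenius_norm_sq_eq_trace, mul_neg, trace_neg, mul_add, trace_add, mul_smul_comm,
      trace_smul, smul_eq_mul]
    ring
  have hμs : m ≤ μ s := hμm s ⟨hs.1, hs.2.le⟩
  have hgap : 0 ≤ trace (Sᵀ * (S * Γ + Γ * S)) :=
    trace_transpose_mul_anticommutator_nonneg S (A s - B s)
  have hyoung := neg_four_mul_trace_residual_mul_le ha X W hlam hm
  have hweight := mul_le_mul_of_nonneg_left (mul_weightedError_le_norm_residual_sq hak X W) hm.le
  have hrate := mul_le_mul_of_nonneg_right hμs (sq_nonneg ‖S‖)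
  rw [hexpand]
  linarith [mul_nonneg (hm.le.trans hμs) hgap]

end IsHyperbolicFlow

end ErrorDecay

variable {d n : ℕ}

section Weight

/-- The number of samples at the position `(i, j)` plus the number of samples at `(j, i)`. -/
def sampleCount (x : Fin n → Fin d × Fin d) (i j : Fin d) : ℕ :=
  Finset.card {k | x k = (i, j)} + Finset.card {k | x k = (j, i)}

/-- The symmetric entry weights for which the training error is a quarter of the weighted squared
error and its gradient in `U` is `residual (weight x) X W * U`. -/
def weight (x : Fin n → Fin d × Fin d) : Matrix (Fin d) (Fin d) ℝ :=
  of fun i j => 2 / n * sampleCount x i j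

variable (x : Fin n → Fin d × Fin d)

theorem weight_apply (i j : Fin d) : weight x i j = 2 / n * sampleCount x i j := rfl

theorem isSymm_weight : (weight x).IsSymm :=
  IsSymm.ext fun i j => by simp only [weight_apply, sampleCount, add_comm]

theorem weight_nonneg (i j : Fin d) : 0 ≤ weight x i j := by
  rw [weight_apply]
  positivity

theorem weight_le_four (i j : Fin d) : weight x i j ≤ 4 := by
  have hcount : sampleCount x i j ≤ n + n :=
    add_le_add (card_finset_fin_le _) (card_finset_fin_le _)
  calc weight x i j ≤ 2 / n * (n + n : ℕ) := by rw [weight_apply]; gcongr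
    _ = 4 * (n / n) := by push_cast; ring
    _ ≤ 4 := by linarith [div_self_le_one (n : ℝ)]

theorem weight_sq_le (i j : Fin d) : weight x i j ^ 2 ≤ 4 * weight x i j := by
  rw [pow_two]
  exact mul_le_mul_of_nonneg_right (weight_le_four x i j) (weight_nonneg x i j)

theorem mul_weight_le_weight_sq (i j : Fin d) : 2 / n * weight x i j ≤ weight x i j ^ 2 := by
  have hcount : (sampleCount x i j : ℝ) ≤ (sampleCount x i j : ℝ) ^ 2 := by
    exact_mod_cast Nat.le_self_pow two_ne_zero _
  calc 2 / n * weight x i j = (2 / n) ^ 2 * sampleCount x i j := by rw [weight_apply]; ring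
    _ ≤ (2 / n) ^ 2 * (sampleCount x i j : ℝ) ^ 2 := by gcongr
    _ = weight x i j ^ 2 := by rw [weight_apply, mul_pow]

variable {x}

theorem weight_pos {i j : Fin d} (hij : (i, j) ∈ observed x ∨ (j, i) ∈ observed x) :
    0 < weight x i j := by
  have hcount : 0 < sampleCount x i j := by
    simpa only [sampleCount, add_pos_iff, Finset.card_pos, Finset.filter_nonempty_iff, observed,
      Finset.mem_image] using hij
  have hn : 0 < n := by
    rcases hij with h | h <;> exact Fin.pos (Finset.mem_image.1 h).choose
  rw [weight_apply]
  positivity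

theorem weight_eq_zero {i j : Fin d} (hij : ¬((i, j) ∈ observed x ∨ (j, i) ∈ observed x)) :
    weight x i j = 0 := by
  have hcount : sampleCount x i j = 0 := by
    simpa only [sampleCount, add_eq_zero, Finset.card_eq_zero, Finset.filter_eq_empty_iff,
      observed, Finset.mem_image, not_or, not_exists, not_and] using hij
  rw [weight_apply, hcount, Nat.cast_zero, mul_zero]

theorem sum_sampleCount_mul (x : Fin n → Fin d × Fin d) {g : Matrix (Fin d) (Fin d) ℝ}
    (hg : g.IsSymm) :
    ∑ i, ∑ j, sampleCount x i j * g i j = 2 * ∑ k, g (x k).1 (x k).2 := by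
  have hfiber : ∑ i, ∑ j, (Finset.card {k | x k = (i, j)} : ℝ) * g i j =
      ∑ k, g (x k).1 (x k).2 := by
    rw [← Finset.sum_fiberwise' Finset.univ x fun q => g q.1 q.2, Fintype.sum_prod_type]
    simp only [Finset.sum_const, nsmul_eq_mul]
  have hswap : ∑ i, ∑ j, (Finset.card {k | x k = (j, i)} : ℝ) * g i j =
      ∑ k, g (x k).1 (x k).2 := by
    rw [Finset.sum_comm, ← hfiber]
    simp only [hg.apply]
  simp only [sampleCount, Nat.cast_add, add_mul, Finset.sum_add_distrib, hfiber, hswap, two_mul]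

end Weight

section Loss

theorem isSymm_matW (θ : Param d) : (matW θ).IsSymm := isSymm_gramDiff _ _

theorem regLoss_eq_weightedError {X : Matrix (Fin d) (Fin d) ℝ} (hX : X.IsSymm)
    (x : Fin n → Fin d × Fin d) (lam : ℝ) (θ : Param d) :
    regLoss X x lam θ = 1 / 4 * weightedError (weight x) X (matW θ) + lam / 2 * ‖θ‖ ^ 2 := by
  have hsymm : (of fun i j => (matW θ i j - X i j) ^ 2).IsSymm := IsSymm.ext fun i j => by
    rw [of_apply, of_apply, (isSymm_matW θ).apply, hX.apply]
  have hcount := sum_sampleCount_mul x hsymm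
  simp only [of_apply] at hcount
  simp only [regLoss, modelOutput, weightedError, weight_apply, mul_assoc, ← Finset.mul_sum,
    hcount]
  ring

theorem contDiff_regLoss (X : Matrix (Fin d) (Fin d) ℝ) (x : Fin n → Fin d × Fin d) (lam : ℝ) :
    ContDiff ℝ 2 (regLoss X x lam) := by
  have hnorm : ContDiff ℝ 2 fun θ : Param d => ‖θ‖ ^ 2 := contDiff_norm_sq ℝ
  unfold regLoss modelOutput matW matU matV
  simp only [Matrix.sub_apply, mul_apply, of_apply, transpose_apply]
  fun_prop

theorem exists_isGradientFlow (X : Matrix (Fin d) (Fin d) ℝ) (x : Fin n → Fin d × Fin d)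
    {lam : ℝ} (hlam : 0 < lam) (θ₀ : Param d) : ∃ θ, IsGradientFlow X x lam θ₀ θ := by
  have hcoercive (θ : Param d) (hθ : regLoss X x lam θ ≤ regLoss X x lam θ₀) :
      ‖θ‖ ≤ √(2 / lam * regLoss X x lam θ₀) := by
    have herror : 0 ≤ (1 / (n : ℝ)) * ∑ k, (modelOutput θ (x k) - X (x k).1 (x k).2) ^ 2 := by
      positivity
    refine Real.le_sqrt_of_sq_le ?_
    calc ‖θ‖ ^ 2 = 2 / lam * (lam / 2 * ‖θ‖ ^ 2) := by field_simp
      _ ≤ 2 / lam * regLoss X x lam θ := by gcongr; exact le_add_of_nonneg_left herror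
      _ ≤ 2 / lam * regLoss X x lam θ₀ := by gcongr
  obtain ⟨γ, hγ₀, hγ⟩ := exists_gradientFlow_of_bounded_sublevel
    (contDiff_regLoss X x lam) hcoercive
  exact ⟨γ, hγ₀, fun t ht => (hγ t ht).hasDerivWithinAt⟩

theorem hasDerivWithinAt_matU {θ : ℝ → Param d} {θ' : Param d} {s : Set ℝ} {t : ℝ}
    (hθ : HasDerivWithinAt θ θ' s t) : HasDerivWithinAt (fun t => matU (θ t)) (matU θ') s t :=
  hasDerivWithinAt_linearMap_comp ⟨⟨matU, fun _ _ => rfl⟩, fun _ _ => rfl⟩ hθ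

theorem hasDerivWithinAt_matV {θ : ℝ → Param d} {θ' : Param d} {s : Set ℝ} {t : ℝ}
    (hθ : HasDerivWithinAt θ θ' s t) : HasDerivWithinAt (fun t => matV (θ t)) (matV θ') s t :=
  hasDerivWithinAt_linearMap_comp ⟨⟨matV, fun _ _ => rfl⟩, fun _ _ => rfl⟩ hθ

/-- The derivative of `matW` at `θ` in the direction `h`. -/
def dirW (θ h : Param d) : Matrix (Fin d) (Fin d) ℝ :=
  matU h * (matU θ)ᵀ + matU θ * (matU h)ᵀ - (matV h * (matV θ)ᵀ + matV θ * (matV h)ᵀ)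

theorem hasDerivWithinAt_matW {θ : ℝ → Param d} {θ' : Param d} {s : Set ℝ} {t : ℝ}
    (hθ : HasDerivWithinAt θ θ' s t) :
    HasDerivWithinAt (fun t => matW (θ t)) (dirW (θ t) θ') s t :=
  have hU := hasDerivWithinAt_matU hθ
  have hV := hasDerivWithinAt_matV hθ
  (hU.mul (hasDerivWithinAt_transpose hU)).sub (hV.mul (hasDerivWithinAt_transpose hV))

theorem inner_pack (P Q : Matrix (Fin d) (Fin d) ℝ) (h : Param d) :
    inner ℝ (pack P Q) h = trace (Pᵀ * matU h) + trace (Qᵀ * matV h) := by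
  simp only [← sum_sum_mul_eq_trace_transpose_mul, PiLp.inner_apply, pack, matU, matV,
    Fintype.sum_sum_type, Fintype.sum_prod_type, Sum.elim_inl, Sum.elim_inr, of_apply,
    Real.inner_apply, mul_comm]

theorem gradient_regLoss {X : Matrix (Fin d) (Fin d) ℝ} (hX : X.IsSymm)
    (x : Fin n → Fin d × Fin d) (lam : ℝ) (θ : Param d) :
    gradient (regLoss X x lam) θ =
      pack (residual (weight x) X (matW θ) * matU θ)
        (-(residual (weight x) X (matW θ) * matV θ)) + lam • θ := by
  have hS := isSymm_residual (isSymm_weight x) hX (isSymm_matW θ)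
  refine ext_inner_right ℝ fun h => ?_
  have hline : HasDerivAt (fun s : ℝ => θ + s • h) h 0 := by
    simpa only [id, one_smul] using ((hasDerivAt_id (0 : ℝ)).smul_const h).const_add θ
  have herror := hasDerivWithinAt_univ.1 (hasDerivWithinAt_weightedError (weight x) X
    (hasDerivWithinAt_matW hline.hasDerivWithinAt))
  have hloss : HasLineDerivAt ℝ (regLoss X x lam)
      (1 / 4 * (2 * trace ((residual (weight x) X (matW θ))ᵀ * dirW θ h)) +
        lam / 2 * (2 * inner ℝ θ h)) θ h := by
    refine ((herror.const_mul (1 / 4)).add (hline.norm_sq.const_mul (lam / 2))).congr_deriv ?_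
      |>.congr_of_eventuallyEq (.of_forall fun s => regLoss_eq_weightedError hX x lam _)
    simp only [zero_smul, add_zero]
  have hdiff := (contDiff_regLoss X x lam).differentiable two_ne_zero θ
  rw [gradient, InnerProductSpace.toDual_symm_apply, ← hdiff.lineDeriv_eq_fderiv, hloss.lineDeriv,
    inner_add_left, inner_pack, inner_smul_left, dirW, Matrix.mul_sub, trace_sub,
    trace_transpose_mul_add_transpose hS, trace_transpose_mul_add_transpose hS, transpose_neg,
    neg_mul, trace_neg, conj_trivial]
  ring

end Loss

section Normalization

/-- The scale `α e^{-λt}` at which the flow from `α • initDir d` would be at time `t` under weight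
decay alone. -/
def decayScale (lam α t : ℝ) : ℝ := α * Real.exp (-(lam * t))

/-- The trajectory `θ` divided by `decayScale lam α`, which removes the weight decay. -/
def normalized (lam α : ℝ) (θ : ℝ → Param d) (t : ℝ) : Param d :=
  (decayScale lam α t)⁻¹ • θ t

variable {lam α : ℝ}

theorem decayScale_pos (lam : ℝ) (hα : 0 < α) (t : ℝ) : 0 < decayScale lam α t :=
  mul_pos hα (Real.exp_pos _)

theorem hasDerivAt_decayScale (lam α t : ℝ) :
    HasDerivAt (decayScale lam α) (-(lam * decayScale lam α t)) t := by
  refine ((hasDerivAt_id t).const_mul lam).neg.exp.const_mul α |>.congr_deriv ?_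
  simp only [decayScale, Pi.neg_apply, id, mul_one]
  ring

theorem hasDerivAt_decayScale_sq (lam α t : ℝ) :
    HasDerivAt (fun t => decayScale lam α t ^ 2) (-(2 * lam * decayScale lam α t ^ 2)) t := by
  refine ((hasDerivAt_decayScale lam α t).pow 2).congr_deriv ?_
  push_cast
  ring

theorem matW_smul (s : ℝ) (θ : Param d) : matW (s • θ) = s ^ 2 • matW θ := by
  have hU : matU (s • θ) = s • matU θ := rfl
  have hV : matV (s • θ) = s • matV θ := rfl
  simp only [matW, hU, hV, transpose_smul, smul_mul_assoc, mul_smul_comm, smul_smul, pow_two,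
    smul_sub]

theorem decayScale_sq_smul_gramDiff_normalized (lam : ℝ) (hα : 0 < α) (θ : ℝ → Param d) (t : ℝ) :
    decayScale lam α t ^ 2 •
      gramDiff (matU (normalized lam α θ t)) (matV (normalized lam α θ t)) = matW (θ t) := by
  change decayScale lam α t ^ 2 • matW (normalized lam α θ t) = matW (θ t)
  rw [← matW_smul, normalized, smul_inv_smul₀ (decayScale_pos lam hα t).ne']

namespace IsGradientFlow

variable {X : Matrix (Fin d) (Fin d) ℝ} {x : Fin n → Fin d × Fin d} {θ : ℝ → Param d}

theorem hasDerivWithinAt_normalized {θ₀ : Param d} (hθ : IsGradientFlow X x lam θ₀ θ)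
    (hX : X.IsSymm) (hα : 0 < α) {t : ℝ} (ht : 0 ≤ t) :
    HasDerivWithinAt (normalized lam α θ)
      (-((decayScale lam α t)⁻¹ • pack (residual (weight x) X (matW (θ t)) * matU (θ t))
        (-(residual (weight x) X (matW (θ t)) * matV (θ t))))) (Set.Ici 0) t := by
  have hscale : decayScale lam α t ≠ 0 := (decayScale_pos lam hα t).ne'
  have hinv : HasDerivAt (decayScale lam α)⁻¹ (lam * (decayScale lam α t)⁻¹) t := by
    refine ((hasDerivAt_decayScale lam α t).inv hscale).congr_deriv ?_
    field_simp
  refine (hinv.hasDerivWithinAt.smul (hθ.2 t ht)).congr_deriv ?_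
  rw [gradient_regLoss hX, Pi.inv_apply]
  module

theorem isHyperbolicFlow (hθ : IsGradientFlow X x lam (α • initDir d) θ) (hX : X.IsSymm)
    (hα : 0 < α) :
    IsHyperbolicFlow (fun t => residual (weight x) X (matW (θ t)))
      (fun t => matU (normalized lam α θ t)) (fun t => matV (normalized lam α θ t)) := by
  have hinit : normalized lam α θ 0 = initDir d := by
    rw [normalized, hθ.1, decayScale, mul_zero, neg_zero, Real.exp_zero, mul_one,
      inv_smul_smul₀ hα.ne']
  have hU (r : ℝ) (S U : Matrix (Fin d) (Fin d) ℝ) : -(r • (S * U)) = -(S * r • U) := by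
    rw [mul_smul_comm]
  have hV (r : ℝ) (S V : Matrix (Fin d) (Fin d) ℝ) : -(r • -(S * V)) = S * r • V := by
    rw [smul_neg, neg_neg, mul_smul_comm]
  exact
    { isSymm := fun t _ => isSymm_residual (isSymm_weight x) hX (isSymm_matW _)
      left_zero := congrArg matU hinit
      right_zero := congrArg matV hinit
      left_deriv := fun t ht => (hasDerivWithinAt_matU
        (hθ.hasDerivWithinAt_normalized hX hα ht)).congr_deriv (hU _ _ (matU (θ t)))
      right_deriv := fun t ht => (hasDerivWithinAt_matV
        (hθ.hasDerivWithinAt_normalized hX hα ht)).congr_deriv (hV _ _ (matV (θ t))) }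

end IsGradientFlow

end Normalization

section ErrorBounds

/-- A constant depending only on the target and the sample, whose square dominates both the
initial error and the coefficient of the bias due to the weight decay. The summand `1` makes it
positive. -/
def errorConst (X : Matrix (Fin d) (Fin d) ℝ) (x : Fin n → Fin d × Fin d) : ℝ :=
  √(weightedError (weight x) X 0 + n / 8 * ‖X‖ ^ 2 + 1)

theorem errorConst_sq (X : Matrix (Fin d) (Fin d) ℝ) (x : Fin n → Fin d × Fin d) :
    errorConst X x ^ 2 = weightedError (weight x) X 0 + n / 8 * ‖X‖ ^ 2 + 1 := by
  have herror₀ := weightedError_nonneg (weight_nonneg x) X 0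
  exact Real.sq_sqrt (by positivity)

theorem errorConst_pos (X : Matrix (Fin d) (Fin d) ℝ) (x : Fin n → Fin d × Fin d) :
    0 < errorConst X x := by
  have herror₀ := weightedError_nonneg (weight_nonneg x) X 0
  exact Real.sqrt_pos.2 (by positivity)

/-- The integral over `[0, t]` of the bound `2 D (e^{-4ms/n} + λ / m)` on the residual at time
`s`, where `D` is `errorConst`. -/
def driftBound (n : ℕ) (D lam m t : ℝ) : ℝ :=
  2 * D * ((1 - Real.exp (-(4 * m / n) * t)) / (4 * m / n) + lam / m * t)

theorem hasDerivAt_driftBound (hn : 0 < n) (D lam t : ℝ) {m : ℝ} (hm : 0 < m) :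
    HasDerivAt (driftBound n D lam m) (2 * D * (Real.exp (-(4 * m / n) * t) + lam / m)) t := by
  have hrate : 4 * m / n ≠ 0 := by positivity
  refine ((((((hasDerivAt_id t).const_mul (-(4 * m / n))).exp.const_sub 1).div_const _).add
    ((hasDerivAt_id t).const_mul (lam / m))).const_mul (2 * D)).congr_deriv ?_
  simp only [id, mul_one, mul_neg, neg_neg, mul_div_cancel_right₀ _ hrate]

theorem driftBound_le {D m : ℝ} (hD : 0 ≤ D) (hm : 0 < m) (lam t : ℝ) :
    driftBound n D lam m t ≤ 2 * D * (n / 4 + lam * t) / m := by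
  calc driftBound n D lam m t ≤ 2 * D * (1 / (4 * m / n) + lam / m * t) := by
        unfold driftBound
        gcongr
        exact sub_le_self _ (Real.exp_pos _).le
    _ = 2 * D * (n / 4 + lam * t) / m := by field_simp

namespace IsGradientFlow

variable {X : Matrix (Fin d) (Fin d) ℝ} {x : Fin n → Fin d × Fin d} {lam α : ℝ} {θ : ℝ → Param d}

theorem weightedError_le (hθ : IsGradientFlow X x lam (α • initDir d) θ) (hn : 0 < n)
    (hX : X.IsSymm) (hlam : 0 ≤ lam) (hα : 0 < α) {T t : ℝ} (ht : t ∈ Set.Icc 0 T) :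
    weightedError (weight x) X (matW (θ t)) ≤ errorConst X x ^ 2 *
      (Real.exp (-(4 * decayScale lam α T ^ 2 / n) * t) ^ 2 +
        (lam / decayScale lam α T ^ 2) ^ 2) := by
  set m := decayScale lam α T ^ 2
  have hm : 0 < m := pow_pos (decayScale_pos lam hα T) 2
  have hscale (s : ℝ) (hs : s ∈ Set.Icc 0 T) : m ≤ decayScale lam α s ^ 2 := by
    gcongr ?_ ^ 2
    · exact (decayScale_pos lam hα T).le
    · unfold decayScale
      gcongr
      exact hs.2
  have hflow := hθ.isHyperbolicFlow hX hα
  simp only [← decayScale_sq_smul_gramDiff_normalized lam hα θ] at hflow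
  have hdecay := hflow.weightedError_le (weight_nonneg x) (by positivity)
    (mul_weight_le_weight_sq x) hlam (hasDerivAt_decayScale_sq lam α) hm hscale ht
  rw [decayScale_sq_smul_gramDiff_normalized lam hα] at hdecay
  have hexp : Real.exp (-(4 * m * (2 / n)) * t) = Real.exp (-(4 * m / n) * t) ^ 2 := by
    rw [← Real.exp_nat_mul]
    congr 1
    push_cast
    ring
  have hbias : lam ^ 2 * ‖X‖ ^ 2 / m / (4 * m * (2 / n)) = n / 8 * ‖X‖ ^ 2 * (lam / m) ^ 2 := by
    field_simp
    ring
  have herror₀ := weightedError_nonneg (weight_nonneg x) X 0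
  calc _ ≤ weightedError (weight x) X 0 * Real.exp (-(4 * m / n) * t) ^ 2 +
        n / 8 * ‖X‖ ^ 2 * (lam / m) ^ 2 := by rwa [hexp, hbias] at hdecay
    _ ≤ errorConst X x ^ 2 * Real.exp (-(4 * m / n) * t) ^ 2 +
        errorConst X x ^ 2 * (lam / m) ^ 2 := by
      rw [errorConst_sq]
      have hX₀ : 0 ≤ n / 8 * ‖X‖ ^ 2 := by positivity
      gcongr <;> linarith
    _ = _ := by ring

theorem norm_residual_le (hθ : IsGradientFlow X x lam (α • initDir d) θ) (hn : 0 < n)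
    (hX : X.IsSymm) (hlam : 0 ≤ lam) (hα : 0 < α) {T t : ℝ} (ht : t ∈ Set.Icc 0 T) :
    ‖residual (weight x) X (matW (θ t))‖ ≤ 2 * errorConst X x *
      (Real.exp (-(4 * decayScale lam α T ^ 2 / n) * t) + lam / decayScale lam α T ^ 2) := by
  set e := Real.exp (-(4 * decayScale lam α T ^ 2 / n) * t)
  set b := lam / decayScale lam α T ^ 2
  have hD := errorConst_pos X x
  have hcross : 0 ≤ e * b := by positivity
  refine le_of_sq_le_sq ?_ (by positivity)
  calc _ ≤ 4 * weightedError (weight x) X (matW (θ t)) := norm_residual_sq_le (weight_sq_le x) _ _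
    _ ≤ 4 * (errorConst X x ^ 2 * (e ^ 2 + b ^ 2)) := by
      gcongr
      exact hθ.weightedError_le hn hX hlam hα ht
    _ ≤ 4 * (errorConst X x ^ 2 * (e + b) ^ 2) := by
      gcongr
      linarith [add_sq e b]
    _ = _ := by ring

theorem abs_matW_apply_le (hθ : IsGradientFlow X x lam (α • initDir d) θ) (hn : 0 < n)
    (hX : X.IsSymm) (hlam : 0 ≤ lam) (hα : 0 < α) {T : ℝ} (hT : 0 ≤ T) {i j : Fin d}
    (hij : weight x i j = 0) {E : ℝ}
    (hE : 2 * errorConst X x * (n / 4 + lam * T) / decayScale lam α T ^ 2 ≤ E)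
    (hsmall : 8 * E ≤ 1) :
    |matW (θ T) i j| ≤ decayScale lam α T ^ 2 * (32 * E ^ 3) := by
  set m := decayScale lam α T ^ 2
  have hm : 0 < m := pow_pos (decayScale_pos lam hα T) 2
  have hD := errorConst_pos X x
  have hdriftE : driftBound n (errorConst X x) lam m T ≤ E :=
    (driftBound_le hD.le hm lam T).trans hE
  have hdrift₀ : driftBound n (errorConst X x) lam m 0 = 0 := by
    simp only [driftBound, mul_zero, Real.exp_zero, sub_self, zero_div, add_zero]
  have hrate_pos (t : ℝ) : 0 < 2 * errorConst X x * (Real.exp (-(4 * m / n) * t) + lam / m) := by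
    positivity
  have hderiv := fun t => hasDerivAt_driftBound hn (errorConst X x) lam t hm
  have hmono := (strictMono_of_hasDerivAt_pos hderiv hrate_pos).monotone hT
  rw [← decayScale_sq_smul_gramDiff_normalized lam hα θ T, Matrix.smul_apply, smul_eq_mul,
    abs_mul, abs_of_pos hm]
  refine mul_le_mul_of_nonneg_left ?_ hm.le
  calc _ ≤ 32 * driftBound n (errorConst X x) lam m T ^ 3 :=
        (hθ.isHyperbolicFlow hX hα).abs_gramDiff_apply_le hderiv hrate_pos hdrift₀
          (fun t ht => hθ.norm_residual_le hn hX hlam hα ht) hT (by linarith)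
          (fun t => by rw [residual_apply, hij, zero_mul])
    _ ≤ 32 * E ^ 3 := by gcongr; linarith

end IsGradientFlow

end ErrorBounds

section KernelTime

/-- The time `T_c⁻(α) = (1 - c) / λ · log α` up to which the flow from scale `α` stays in the
kernel regime. -/
def kernelTime (c lam α : ℝ) : ℝ := (1 - c) / lam * Real.log α

variable {c : ℝ}

theorem mul_kernelTime (c : ℝ) {lam : ℝ} (hlam : lam ≠ 0) (α : ℝ) :
    lam * kernelTime c lam α = (1 - c) * Real.log α := by
  rw [kernelTime]
  field_simp

theorem kernelTime_nonneg (hc : c ≤ 1) {lam α : ℝ} (hlam : 0 ≤ lam) (hα : 1 ≤ α) :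
    0 ≤ kernelTime c lam α :=
  mul_nonneg (div_nonneg (sub_nonneg.2 hc) hlam) (Real.log_nonneg hα)

theorem decayScale_kernelTime_sq (c : ℝ) {lam α : ℝ} (hlam : lam ≠ 0) (hα : 0 < α) :
    decayScale lam α (kernelTime c lam α) ^ 2 = α ^ (2 * c) := by
  have hscale : decayScale lam α (kernelTime c lam α) = α ^ c := by
    rw [decayScale, mul_kernelTime c hlam, Real.rpow_def_of_pos hα]
    nth_rw 1 [← Real.exp_log hα]
    rw [← Real.exp_add]
    ring_nf
  rw [hscale, mul_comm, Real.rpow_mul hα.le, Real.rpow_two]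

theorem tendsto_exp_neg_rpow_mul_kernelTime (hc : c < 1) {lam : ℝ → ℝ}
    (hlam_pos : ∀ α : ℝ, 0 < α → 0 < lam α) (hlam : lam =o[atTop] fun α : ℝ => α ^ (2 * c))
    {k : ℝ} (hk : 0 < k) :
    Tendsto (fun α : ℝ => Real.exp (-(k * α ^ (2 * c) * kernelTime c (lam α) α)))
      atTop (𝓝 0) := by
  have hratio : Tendsto (fun α : ℝ => (lam α / α ^ (2 * c))⁻¹) atTop atTop := by
    refine Tendsto.inv_tendsto_nhdsGT_zero
      (tendsto_nhdsWithin_iff.2 ⟨hlam.tendsto_div_nhds_zero, ?_⟩)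
    filter_upwards [eventually_gt_atTop 0] with α hα
    exact div_pos (hlam_pos α hα) (Real.rpow_pos_of_pos hα _)
  refine Real.tendsto_exp_neg_atTop_nhds_zero.comp <|
    ((hratio.atTop_mul_atTop₀ Real.tendsto_log_atTop).const_mul_atTop
      (mul_pos hk (sub_pos.2 hc))).congr fun α => ?_
  rw [kernelTime, inv_div]
  ring

theorem tendsto_add_mul_log_div_rpow (b k : ℝ) {r : ℝ} (hr : 0 < r) :
    Tendsto (fun α : ℝ => (b + k * Real.log α) / α ^ r) atTop (𝓝 0) := by
  have hconst : (fun _ : ℝ => b) =o[atTop] fun α : ℝ => α ^ r :=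
    isLittleO_const_left.2 (.inr (tendsto_norm_atTop_atTop.comp (tendsto_rpow_atTop hr)))
  exact (hconst.add ((isLittleO_log_rpow_atTop hr).const_mul_left k)).tendsto_div_nhds_zero

variable {X : Matrix (Fin d) (Fin d) ℝ} {x : Fin n → Fin d × Fin d} {lam : ℝ → ℝ}
  {θ : ℝ → ℝ → Param d}

theorem tendsto_weightedError_kernelTime (hn : 0 < n) (hX : X.IsSymm)
    (hlam_pos : ∀ α : ℝ, 0 < α → 0 < lam α) (hlam : lam =o[atTop] fun α : ℝ => α ^ (2 * c))
    (hc : c < 1) (hθ : ∀ α : ℝ, 0 < α → IsGradientFlow X x (lam α) (α • initDir d) (θ α)) :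
    Tendsto (fun α => weightedError (weight x) X (matW (θ α (kernelTime c (lam α) α))))
      atTop (𝓝 0) := by
  have hexp := tendsto_exp_neg_rpow_mul_kernelTime hc hlam_pos hlam (k := 4 / n) (by positivity)
  have hlim := ((hexp.pow 2).add (hlam.tendsto_div_nhds_zero.pow 2)).const_mul (errorConst X x ^ 2)
  rw [zero_pow two_ne_zero, add_zero, mul_zero] at hlim
  refine squeeze_zero' (.of_forall fun α => weightedError_nonneg (weight_nonneg x) _ _) ?_ hlim
  filter_upwards [eventually_ge_atTop 1] with α hα
  have hα₀ : 0 < α := one_pos.trans_le hα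
  have hpos := hlam_pos α hα₀
  have hbound := (hθ α hα₀).weightedError_le hn hX hpos.le hα₀
    ⟨kernelTime_nonneg hc.le hpos.le hα, le_rfl⟩
  rwa [decayScale_kernelTime_sq c hpos.ne' hα₀, neg_mul, mul_div_right_comm] at hbound

theorem tendsto_matW_kernelTime_of_weight_eq_zero (hn : 0 < n) (hX : X.IsSymm)
    (hlam_pos : ∀ α : ℝ, 0 < α → 0 < lam α) (hc : c ∈ Set.Ioo (0 : ℝ) 1)
    (hθ : ∀ α : ℝ, 0 < α → IsGradientFlow X x (lam α) (α • initDir d) (θ α)) {i j : Fin d}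
    (hij : weight x i j = 0) :
    Tendsto (fun α => matW (θ α (kernelTime c (lam α) α)) i j) atTop (𝓝 0) := by
  let E (α : ℝ) : ℝ := 2 * errorConst X x * (n / 4 + (1 - c) * Real.log α) / α ^ (2 * c)
  have hE : Tendsto E atTop (𝓝 0) := by
    have hlog := (tendsto_add_mul_log_div_rpow (n / 4) (1 - c)
      (mul_pos two_pos hc.1)).const_mul (2 * errorConst X x)
    rw [mul_zero] at hlog
    exact hlog.congr fun α => (mul_div_assoc _ _ _).symm
  have hlim : Tendsto (fun α : ℝ => α ^ (2 * c) * (32 * E α ^ 3)) atTop (𝓝 0) := by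
    have hlog := ((tendsto_add_mul_log_div_rpow (n / 4) (1 - c) (r := 2 * (2 * c) / 3)
      (by linarith [hc.1])).pow 3).const_mul (32 * (2 * errorConst X x) ^ 3)
    rw [zero_pow three_ne_zero, mul_zero] at hlog
    refine hlog.congr' ?_
    filter_upwards [eventually_gt_atTop 0] with α hα
    have hpow : (α ^ (2 * (2 * c) / 3)) ^ 3 = (α ^ (2 * c)) ^ 2 := by
      rw [← Real.rpow_mul_natCast hα.le, ← Real.rpow_mul_natCast hα.le]
      ring_nf
    have hscale : α ^ (2 * c) ≠ 0 := (Real.rpow_pos_of_pos hα _).ne'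
    rw [div_pow, hpow]
    simp only [E]
    field_simp [hscale]
  refine squeeze_zero_norm' ?_ hlim
  filter_upwards [eventually_ge_atTop 1,
    (hE.const_mul 8).eventually_le_const (u := 1) (by norm_num)] with α hα hsmall
  have hα₀ : 0 < α := one_pos.trans_le hα
  have hpos := hlam_pos α hα₀
  have hbound := (hθ α hα₀).abs_matW_apply_le hn hX hpos.le hα₀
    (kernelTime_nonneg hc.2.le hpos.le hα) hij (E := E α)
  rw [decayScale_kernelTime_sq c hpos.ne' hα₀, mul_kernelTime c hpos.ne'] at hbound
  exact hbound le_rfl hsmall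

end KernelTime

theorem isLittleO_rpow_rpow_atTop {p q : ℝ} (hpq : p < q) :
    (fun α : ℝ => α ^ p) =o[atTop] fun α : ℝ => α ^ q := by
  refine (isLittleO_iff_tendsto' ?_).2 ?_
  · filter_upwards [eventually_gt_atTop 0] with α hα hzero
    exact absurd hzero (Real.rpow_pos_of_pos hα q).ne'
  refine (tendsto_rpow_neg_atTop (sub_pos.2 hpq)).congr' ?_
  filter_upwards [eventually_gt_atTop 0] with α hα
  rw [neg_sub, Real.rpow_sub hα]

end MatrixCompletion

end

theorem mainTheorem7_general {d n : ℕ} (hn : 0 < n)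
    (Xstar : Matrix (Fin d) (Fin d) ℝ) (hX : Xstar.IsSymm)
    (x : Fin n → Fin d × Fin d)
    (lam : ℝ → ℝ) (hlam_pos : ∀ α : ℝ, 0 < α → 0 < lam α)
    (c : ℝ) (hc : c ∈ Set.Ioo (0 : ℝ) 1) (hlam : lam =o[atTop] fun α : ℝ => α ^ (2 * c)) :
    (∀ α : ℝ, 0 < α → ∃ θ : ℝ → MatrixCompletion.Param d,
      MatrixCompletion.IsGradientFlow Xstar x (lam α) (α • MatrixCompletion.initDir d) θ) ∧
    ∀ θ : ℝ → ℝ → MatrixCompletion.Param d,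
      (∀ α : ℝ, 0 < α →
        MatrixCompletion.IsGradientFlow Xstar x (lam α) (α • MatrixCompletion.initDir d) (θ α)) →
      ∀ i j : Fin d,
        Tendsto (fun α : ℝ => MatrixCompletion.matW (θ α ((1 - c) / lam α * Real.log α)) i j)
          atTop
          (𝓝 (if (i, j) ∈ MatrixCompletion.observed x ∨ (j, i) ∈ MatrixCompletion.observed x
            then Xstar i j else 0)) := by
  refine ⟨fun α hα => MatrixCompletion.exists_isGradientFlow Xstar x (hlam_pos α hα) _,
    fun θ hθ i j => ?_⟩
  split_ifs with hij
  · exact MatrixCompletion.tendsto_apply_of_tendsto_weightedError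
      (MatrixCompletion.weight_nonneg x)
      (MatrixCompletion.tendsto_weightedError_kernelTime hn hX hlam_pos hlam hc.2 hθ)
      (MatrixCompletion.weight_pos hij)
  · exact MatrixCompletion.tendsto_matW_kernelTime_of_weight_eq_zero hn hX hlam_pos hc hθ
      (MatrixCompletion.weight_eq_zero hij)

theorem mainTheorem7 {d n : ℕ} (hn : 0 < n)
    (Xstar : Matrix (Fin d) (Fin d) ℝ) (hX : Xstar.IsSymm)
    (x : Fin n → Fin d × Fin d)
    (lam : ℝ → ℝ) (hlam_pos : ∀ α : ℝ, 0 < α → 0 < lam α)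
    (p : ℝ) (hp : 0 < p) (hlam : lam =Θ[atTop] fun α : ℝ => α ^ (-p))
    (c : ℝ) (hc : c ∈ Set.Ioo (0 : ℝ) 1) :
    (∀ α : ℝ, 0 < α → ∃ θ : ℝ → MatrixCompletion.Param d,
      MatrixCompletion.IsGradientFlow Xstar x (lam α) (α • MatrixCompletion.initDir d) θ) ∧
    ∀ θ : ℝ → ℝ → MatrixCompletion.Param d,
      (∀ α : ℝ, 0 < α →
        MatrixCompletion.IsGradientFlow Xstar x (lam α) (α • MatrixCompletion.initDir d) (θ α)) →
      ∀ i j : Fin d,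
        Tendsto (fun α : ℝ => MatrixCompletion.matW (θ α ((1 - c) / lam α * Real.log α)) i j)
          atTop
          (𝓝 (if (i, j) ∈ MatrixCompletion.observed x ∨ (j, i) ∈ MatrixCompletion.observed x
            then Xstar i j else 0)) := by
  have hpow := MatrixCompletion.isLittleO_rpow_rpow_atTop (show -p < 2 * c by linarith [hc.1])
  exact mainTheorem7_general hn Xstar hX x lam hlam_pos c hc (hlam.isBigO.trans_isLittleO hpow)
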